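/- Let $G$ be an abelian (additively written) second countable locally compact Hausdorff group with Haar measure $h$ (written $dt$), let $(\Omega,\mu)$ be a $\sigma$-finite resonant measure space, and let $\alpha$ be an action of $G$ on $\Omega$ such that $(\omega,t)\mapsto\alpha_t(\omega)$ is measurable on $\Omega\times G$ and every $\alpha_t$ preserves $\mu$. (Resonant means that $\int_0^\infty f^*(t)g^*(t)\,dt=\sup\int_\Omega|f\tilde g|\,d\mu$ for all measurable a.e. finite $f,g$, the supremum being over all $\tilde g$ equimeasurable with $g$; here $f^*(t)=\inf\{s\ge 0:\mu(|f|>s)\le t\}$.) Assume that the induced action on $L^\infty(\Omega)$ is point-weak* continuous: for all $f\in L^\infty(\Omega)$ and $g\in L^1(\Omega)$ the function $t\mapsto\int_\Omega f(\alpha_t\omega)g(\omega)\,d\mu(\omega)$ is continuous on $G$. Let $(k_n)$ be a sequence of bounded functions in $L^1(G)$, each vanishing a.e. outside some compact set, and put $T_n(g)=k_n*g$ for $g\in L^{\rm loc}(G)$, where $L^{\rm loc}$ denotes the functions that are integrable over all sets of finite measure. Let $T_n^\#$ be the transferred operator: for $f\in L^1(\Omega)+L^\infty(\Omega)$ put $F(\omega,t)=f(\alpha_t\omega)$;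 then $T_n^\# f\in L^{\rm loc}(\Omega)$ is the limit of the functions $\omega\mapsto T_n(S(\omega))(0)$ as the simple functions $S:\Omega\to L^{\rm loc}(G)$ tend to $F$ with respect to the seminorms $\int_{A\times B}|\cdot|\,d(\mu\times h)$, with $A\subseteq\Omega$ and $B\subseteq G$ of finite measure. (Explicitly, $T_n^\#f(\omega)=\int_G k_n(s)f(\alpha_{-s}\omega)\,ds$ for a.e. $\omega$.) Put $T^\#f=\sup_n|T_n^\#f|$. Suppose that the sequence $\big(\int_G k_n(t)\,dt\big)$ converges, and that $(k_n*\phi)$ converges weakly in $L^1(G)$ for every $\phi\in L^1(G)$ whose support has finite measure. Let $\Phi$ be a Young's function that satisfies the $\Delta_2$ condition globally, i.e. $\Phi(2x)\le K\Phi(x)$ for some constant $K>0$ and all $x\ge0$. Let $X$ be the Orlicz space of $\Phi$ over $(\Omega,\mu)$ with the Luxemburg norm $\|f\|_X=\inf\{1/k: k>0,\ \int_\Omega\Phi(k|f|)\,d\mu\le1\}$. Let $Y$ be a rearrangement invariant Banach function space over $(\Omega,\mu)$ with fundamental function $\varphi_Y$, that is, $\varphi_Y$ is a quasiconcave function on $[0,\infty)$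 with $\varphi_Y(\mu(E))=\|\chi_E\|_Y$ for all measurable $E$ of finite measure. Suppose that $T^\#$ has weak type $(X,Y)$: there is a constant $c$ such that $$\sup_{t>0}\,(T^\#f)^*(t)\,\varphi_Y(t)\le c\,\|f\|_X\qquad\text{for all }f\in X.$$ Then for every $f\in X$ the sequence $(T_n^\# f(\omega))_n$ converges for $\mu$-a.e. $\omega\in\Omega$. -/

import Mathlib

open MeasureTheory Filter Topology Set
open scoped ENNReal NNReal

namespace Transfer

noncomputable section

/-! ### Rearrangements and resonant measure spaces -/

/-- The distribution function `m(u, s) = μ {u > s}` of a non-negative function `u`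
(applied below to `u = |f|`). -/
def distribution {Ω : Type*} [MeasurableSpace Ω] (μ : Measure Ω) (u : Ω → ℝ≥0∞) (s : ℝ≥0∞) :
    ℝ≥0∞ :=
  μ {ω | s < u ω}

/-- The decreasing rearrangement `u^*(t) = inf {s : m(u, s) ≤ t}`. -/
def rearrangement {Ω : Type*} [MeasurableSpace Ω] (μ : Measure Ω) (u : Ω → ℝ≥0∞) (t : ℝ≥0∞) :
    ℝ≥0∞ :=
  sInf {s | distribution μ u s ≤ t}

/-- Equimeasurability: equality of the distribution functions. -/
def Equimeasurable {Ω : Type*} [MeasurableSpace Ω] (μ : Measure Ω) (u v : Ω → ℝ≥0∞) : Prop :=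
  ∀ s : ℝ≥0, distribution μ u s = distribution μ v s

/-- `(Ω, μ)` is resonant: `∫₀^∞ f^* g^* dt` is the supremum of `∫ |f g'| dμ` over the functions
`g'` equimeasurable with `g`. -/
def IsResonant {Ω : Type*} [MeasurableSpace Ω] (μ : Measure Ω) : Prop :=
  ∀ f g : Ω → ℂ, AEStronglyMeasurable f μ → AEStronglyMeasurable g μ →
    ∫⁻ t in Ioi (0 : ℝ), rearrangement μ (fun ω => ‖f ω‖ₑ) (ENNReal.ofReal t) *
        rearrangement μ (fun ω => ‖g ω‖ₑ) (ENNReal.ofReal t) =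
      ⨆ (g' : Ω → ℂ) (_ : AEStronglyMeasurable g' μ)
        (_ : Equimeasurable μ (fun ω => ‖g' ω‖ₑ) (fun ω => ‖g ω‖ₑ)),
        ∫⁻ ω, ‖f ω * g' ω‖ₑ ∂μ

/-! ### Rearrangement invariant Banach function spaces and weak type -/

/-- A rearrangement invariant Banach function norm on `(Ω, μ)`, as a functional on the
non-negative measurable functions.  The space consists of the measurable functions `f` for which
`|f|` has finite norm. -/
structure RIFunctionNorm {Ω : Type*} [MeasurableSpace Ω] (μ : Measure Ω) where
  /-- the norm of a non-negative measurable function -/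
  norm : (Ω → ℝ≥0∞) → ℝ≥0∞
  norm_eq_zero_iff : ∀ u, AEMeasurable u μ → (norm u = 0 ↔ u =ᵐ[μ] 0)
  norm_smul : ∀ (a : ℝ≥0) (u), AEMeasurable u μ → norm (fun ω => a * u ω) = a * norm u
  norm_add_le : ∀ u v, AEMeasurable u μ → AEMeasurable v μ →
    norm (fun ω => u ω + v ω) ≤ norm u + norm v
  norm_mono : ∀ u v, AEMeasurable u μ → AEMeasurable v μ → u ≤ᵐ[μ] v → norm u ≤ norm v
  /-- the Fatou property -/
  norm_iSup : ∀ (u : ℕ → Ω → ℝ≥0∞) (v : Ω → ℝ≥0∞), (∀ n, AEMeasurable (u n) μ) →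
    AEMeasurable v μ → (∀ᵐ ω ∂μ, Monotone fun n => u n ω) →
    (∀ᵐ ω ∂μ, ⨆ n, u n ω = v ω) → ⨆ n, norm (u n) = norm v
  norm_indicator_lt_top : ∀ E, MeasurableSet E → μ E < ∞ →
    norm (E.indicator fun _ => 1) < ∞
  lintegral_le : ∀ E, MeasurableSet E → μ E < ∞ →
    ∃ C : ℝ≥0, ∀ u, AEMeasurable u μ → ∫⁻ ω in E, u ω ∂μ ≤ C * norm u
  /-- rearrangement invariance -/
  norm_congr : ∀ u v, AEMeasurable u μ → AEMeasurable v μ → (∀ᵐ ω ∂μ, u ω < ∞) →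
    (∀ᵐ ω ∂μ, v ω < ∞) → Equimeasurable μ u v → norm u = norm v

/-- Quasiconcave functions on `[0, ∞)`. -/
structure IsQuasiconcave (φ : ℝ≥0 → ℝ≥0) : Prop where
  eq_zero_iff : ∀ t, φ t = 0 ↔ t = 0
  mono : Monotone φ
  div_anti : ∀ s t, 0 < s → s ≤ t → φ t / t ≤ φ s / s

/-- `φ` is a fundamental function of `Y`: a quasiconcave function on all of `[0, ∞)` such that
`φ (μ E) = ‖χ_E‖_Y` for every measurable set `E` of finite measure. -/
def RIFunctionNorm.IsFundamentalFunction {Ω : Type*} [MeasurableSpace Ω] {μ : Measure Ω}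
    (Y : RIFunctionNorm μ) (φ : ℝ≥0 → ℝ≥0) : Prop :=
  IsQuasiconcave φ ∧ ∀ E, MeasurableSet E → μ E < ∞ →
    Y.norm (E.indicator fun _ => 1) = φ (μ E).toNNReal

/-- The quasi-norm `‖u‖_{M^*(φ)} = sup_{t > 0} u^*(t) φ(t)`. -/
def mStarNorm {Ω : Type*} [MeasurableSpace Ω] (μ : Measure Ω) (φ : ℝ≥0 → ℝ≥0)
    (u : Ω → ℝ≥0∞) : ℝ≥0∞ :=
  ⨆ (t : ℝ≥0) (_ : 0 < t), rearrangement μ u t * φ t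

/-! ### Orlicz spaces -/

/-- Young's functions.  Functions in Orlicz spaces are finite almost everywhere, so the value at
`∞` (necessarily `∞`) plays no role. -/
structure IsYoungFunction (Φ : ℝ≥0 → ℝ≥0∞) : Prop where
  convex : ConvexOn ℝ≥0 univ Φ
  mono : Monotone Φ
  map_zero : Φ 0 = 0
  tendsto_top : Tendsto Φ atTop (𝓝 ∞)
  exists_ne_top : ∃ x, 0 < x ∧ Φ x ≠ ∞

/-- The global `Δ₂` condition. -/
def Delta2 (Φ : ℝ≥0 → ℝ≥0∞) : Prop :=
  ∃ K : ℝ≥0, 0 < K ∧ ∀ x, Φ (2 * x) ≤ K * Φ x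

/-- The Luxemburg norm `inf {1/k : ∫ Φ(k |f|) dμ ≤ 1}`. -/
def luxemburgNorm {Ω : Type*} [MeasurableSpace Ω] (μ : Measure Ω) (Φ : ℝ≥0 → ℝ≥0∞)
    (f : Ω → ℂ) : ℝ≥0∞ :=
  ⨅ (k : ℝ≥0) (_ : 0 < k) (_ : ∫⁻ ω, Φ (k * ‖f ω‖₊) ∂μ ≤ 1), (k : ℝ≥0∞)⁻¹

/-- Membership in the Orlicz space of `Φ` over `(Ω, μ)`. -/
def MemOrlicz {Ω : Type*} [MeasurableSpace Ω] (μ : Measure Ω) (Φ : ℝ≥0 → ℝ≥0∞)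
    (f : Ω → ℂ) : Prop :=
  AEStronglyMeasurable f μ ∧ luxemburgNorm μ Φ f < ∞

/-- The operator `S` (with values `|S f|` in `[0, ∞]`) is of weak type `(X, Y)`, where `X` is the
Orlicz space of `Φ` and `Y` has the fundamental function `φ`: it is bounded from `X` into
`M^*(φ)`. -/
def HasWeakType {Ω : Type*} [MeasurableSpace Ω] (μ : Measure Ω) (Φ : ℝ≥0 → ℝ≥0∞)
    (φ : ℝ≥0 → ℝ≥0) (S : (Ω → ℂ) → Ω → ℝ≥0∞) : Prop :=
  ∃ c : ℝ≥0, ∀ f, MemOrlicz μ Φ f → mStarNorm μ φ (S f) ≤ c * luxemburgNorm μ Φ f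

/-! ### Convolution operators, weak convergence and continuity of the action -/

/-- The convolution operator `f ↦ k * f`. -/
def convOp {G : Type*} [AddCommGroup G] [MeasurableSpace G] (h : Measure G)
    (k f : G → ℂ) : G → ℂ :=
  convolution k f (ContinuousLinearMap.mul ℂ ℂ) h

/-- Weak convergence in `L¹` of a sequence of functions, through the duality with `L^∞`. -/
def ConvergesWeaklyL1 {G : Type*} [MeasurableSpace G] (h : Measure G) (u : ℕ → G → ℂ) : Prop :=
  ∃ v, Integrable v h ∧ ∀ w, MemLp w ∞ h →
    Tendsto (fun n => ∫ t, u n t * w t ∂h) atTop (𝓝 (∫ t, v t * w t ∂h))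

/-- The action induced on `L^∞(Ω)` is point-weak* continuous. -/
def IsPointWeakStarContinuous (G : Type*) {Ω : Type*} [TopologicalSpace G] [MeasurableSpace Ω]
    [VAdd G Ω] (μ : Measure Ω) : Prop :=
  ∀ f : Ω → ℂ, MemLp f ∞ μ → ∀ g : Ω → ℂ, Integrable g μ →
    Continuous fun t : G => ∫ ω, f (t +ᵥ ω) * g ω ∂μ

/-! ### The transferred operator -/

/-- The space `L^loc`: functions integrable over every set of finite measure. -/
def LocInt {Ω : Type*} [MeasurableSpace Ω] (μ : Measure Ω) (f : Ω → ℂ) : Prop :=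
  AEStronglyMeasurable f μ ∧ ∀ A, MeasurableSet A → μ A < ∞ → ∫⁻ ω in A, ‖f ω‖ₑ ∂μ < ∞

/-- `g` represents the transfer `T^# f` of the operator `T` on functions over `G`.

Put `F(ω, t) = f(α_t ω)`, a rectangular locally integrable function on `Ω × G`.  On simple
functions `S : Ω → L^loc(G)` the extension of `T` is `S ↦ T ∘ S`; it is extended by continuity
to `F`, for the seminorms `∫_{A × B} |·| d(μ × h)` with `A`, `B` of finite measure, and the
result is evaluated at the identity of `G`.  Thus `T^# f` is the limit in `L^loc(Ω)` of
`ω ↦ T(S ω)(0)` as the simple function `S` tends to `F`. -/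
def IsTransfer {G Ω : Type*} [AddCommGroup G] [MeasurableSpace G] [MeasurableSpace Ω]
    [AddAction G Ω] (h : Measure G) (μ : Measure Ω) (T : (G → ℂ) → G → ℂ) (f g : Ω → ℂ) : Prop :=
  LocInt μ g ∧
  ∀ A, MeasurableSet A → μ A < ∞ → ∀ ε : ℝ≥0∞, 0 < ε →
    ∃ (A' : Set Ω) (B : Set G) (δ : ℝ≥0∞), MeasurableSet A' ∧ μ A' < ∞ ∧ MeasurableSet B ∧
      h B < ∞ ∧ 0 < δ ∧
      ∀ S : SimpleFunc Ω (G → ℂ), (∀ ω, LocInt h (S ω)) →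
        ∫⁻ p in A' ×ˢ B, ‖S p.1 p.2 - f (p.2 +ᵥ p.1)‖ₑ ∂(μ.prod h) < δ →
        ∫⁻ ω in A, ‖T (S ω) 0 - g ω‖ₑ ∂μ < ε

open Classical in
/-- The transferred operator `T^#` (a representative of the almost everywhere class `T^# f`). -/
def transfer {G Ω : Type*} [AddCommGroup G] [MeasurableSpace G] [MeasurableSpace Ω]
    [AddAction G Ω] (h : Measure G) (μ : Measure Ω) (T : (G → ℂ) → G → ℂ) (f : Ω → ℂ) : Ω → ℂ :=
  if H : ∃ g, IsTransfer h μ T f g then H.choose else 0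


/-! ### The transfer of a convolution operator is well defined -/

/-- Simple functions with jointly measurable bounded values are dense in the functions integrable
over a product of sets of finite measure. -/
theorem exists_simpleFunc_approx {G Ω : Type*} [MeasurableSpace G] [MeasurableSpace Ω]
    (m : Measure (Ω × G)) [IsFiniteMeasure m] (F : Ω × G → ℂ) (hF : Integrable F m) :
    ∀ δ : ℝ≥0∞, δ ≠ 0 → ∃ S : SimpleFunc Ω (G → ℂ), Measurable (fun p : Ω × G => S p.1 p.2) ∧
      (∃ C : ℝ≥0, ∀ ω t, ‖S ω t‖ₑ ≤ C) ∧ ∫⁻ p, ‖S p.1 p.2 - F p‖ₑ ∂m < δ := by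
  set P : (Ω × G → ℂ) → Prop := fun F => ∀ δ : ℝ≥0∞, δ ≠ 0 → ∃ S : SimpleFunc Ω (G → ℂ),
    Measurable (fun p : Ω × G => S p.1 p.2) ∧
      (∃ C : ℝ≥0, ∀ ω t, ‖S ω t‖ₑ ≤ C) ∧ ∫⁻ p, ‖S p.1 p.2 - F p‖ₑ ∂m < δ with hP
  have P_add : ∀ F₁ F₂, AEStronglyMeasurable F₁ m → P F₁ → P F₂ → P (F₁ + F₂) := by
    intro F₁ F₂ hm h1 h2 δ hδ
    obtain ⟨S, hS, ⟨C, hC⟩, hSd⟩ := h1 (δ / 2) (by simpa using hδ)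
    obtain ⟨S', hS', ⟨C', hC'⟩, hSd'⟩ := h2 (δ / 2) (by simpa using hδ)
    refine ⟨S + S', ?_, ⟨C + C', fun ω t => ?_⟩, ?_⟩
    · exact hS.add hS'
    · simp only [SimpleFunc.coe_add, Pi.add_apply, ENNReal.coe_add]
      exact (enorm_add_le _ _).trans (add_le_add (hC _ _) (hC' _ _))
    · calc _ ≤ ∫⁻ p, (‖S p.1 p.2 - F₁ p‖ₑ + ‖S' p.1 p.2 - F₂ p‖ₑ) ∂m := by
            refine lintegral_mono fun p => ?_
            simp only [SimpleFunc.coe_add, Pi.add_apply]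
            rw [add_sub_add_comm]
            exact enorm_add_le _ _
        _ = _ := lintegral_add_left'
            ((hS.aestronglyMeasurable.sub hm).enorm) _
        _ < δ / 2 + δ / 2 := ENNReal.add_lt_add hSd hSd'
        _ = δ := ENNReal.add_halves δ
  have P_smul : ∀ (c : ℂ) F, P F → P (fun p => c * F p) := by
    intro c F hF δ hδ
    obtain ⟨S, hS, ⟨C, hC⟩, hSd⟩ := hF (δ / (‖c‖ₑ + 1)) (by simp [hδ, ENNReal.div_eq_zero_iff])
    refine ⟨S.map fun g => fun t => c * g t, ?_, ⟨‖c‖₊ * C, fun ω t => ?_⟩, ?_⟩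
    · simpa using hS.const_mul c
    · simp only [SimpleFunc.map_apply, enorm_mul, ENNReal.coe_mul]
      exact mul_le_mul' le_rfl (hC _ _)
    · calc _ = ∫⁻ p, ‖c‖ₑ * ‖S p.1 p.2 - F p‖ₑ ∂m := by
            refine lintegral_congr fun p => ?_
            simp only [SimpleFunc.map_apply]
            rw [← mul_sub, enorm_mul]
        _ = ‖c‖ₑ * ∫⁻ p, ‖S p.1 p.2 - F p‖ₑ ∂m := lintegral_const_mul' _ _ (by simp)
        _ ≤ (‖c‖ₑ + 1) * ∫⁻ p, ‖S p.1 p.2 - F p‖ₑ ∂m := by gcongr; exact le_self_add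
        _ < δ := by
            rw [mul_comm]
            exact (ENNReal.lt_div_iff_mul_lt (Or.inl (by simp)) (Or.inl (by simp))).1 hSd
  have P_lim : ∀ F, AEStronglyMeasurable F m → (∀ δ : ℝ≥0∞, δ ≠ 0 →
      ∃ F', P F' ∧ ∫⁻ p, ‖F' p - F p‖ₑ ∂m < δ ∧ AEStronglyMeasurable F' m) → P F := by
    intro F hm hF δ hδ
    obtain ⟨F', hF', hd, hm'⟩ := hF (δ / 2) (by simpa using hδ)
    obtain ⟨S, hS, hC, hSd⟩ := hF' (δ / 2) (by simpa using hδ)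
    refine ⟨S, hS, hC, ?_⟩
    calc _ ≤ ∫⁻ p, (‖S p.1 p.2 - F' p‖ₑ + ‖F' p - F p‖ₑ) ∂m := by
          refine lintegral_mono fun p => ?_
          rw [← sub_add_sub_cancel (S p.1 p.2) (F' p) (F p)]
          exact enorm_add_le _ _
      _ = _ := lintegral_add_left' ((hS.aestronglyMeasurable.sub hm').enorm) _
      _ < δ / 2 + δ / 2 := ENNReal.add_lt_add hSd hd
      _ = δ := ENNReal.add_halves δ
  have P_simple : ∀ S : SimpleFunc Ω (G → ℂ), Measurable (fun p : Ω × G => S p.1 p.2) →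
      (∃ C : ℝ≥0, ∀ ω t, ‖S ω t‖ₑ ≤ C) → P (fun p => S p.1 p.2) := by
    intro S h1 h2 δ hδ
    exact ⟨S, h1, h2, by simpa using pos_iff_ne_zero.2 hδ⟩
  have P_rect : ∀ A : Set Ω, MeasurableSet A → ∀ B : Set G, MeasurableSet B →
      P ((A ×ˢ B).indicator fun _ => 1) := by
    intro A hA B hB
    have := P_simple (SimpleFunc.piecewise A hA (SimpleFunc.const Ω (B.indicator fun _ => (1 : ℂ)))
      (SimpleFunc.const Ω 0))
    have e : (fun p : Ω × G => (SimpleFunc.piecewise A hA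
        (SimpleFunc.const Ω (B.indicator fun _ => (1 : ℂ))) (SimpleFunc.const Ω 0)) p.1 p.2) =
        (A ×ˢ B).indicator fun _ => 1 := by
      classical
      ext p
      by_cases h1 : p.1 ∈ A <;> by_cases h2 : p.2 ∈ B <;>
        simp [Set.indicator, h1, h2]
    rw [e] at this
    refine this (measurable_const.indicator (hA.prod hB)) ⟨1, fun ω t => ?_⟩
    have := congrFun e (ω, t)
    simp only at this
    rw [this]
    by_cases h : (ω, t) ∈ A ×ˢ B <;> simp [Set.indicator, h]
  have P_set : ∀ s : Set (Ω × G), MeasurableSet s → P (s.indicator fun _ => 1) := by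
    intro s hs
    induction s, hs using MeasurableSpace.induction_on_inter generateFrom_prod.symm
      isPiSystem_prod with
    | empty => simpa using P_rect ∅ MeasurableSet.empty ∅ MeasurableSet.empty
    | basic s hs =>
      obtain ⟨A, hA, B, hB, rfl⟩ := hs
      exact P_rect A hA B hB
    | compl s hs ih =>
      have h1 : P ((univ ×ˢ univ : Set (Ω × G)).indicator fun _ => 1) :=
        P_rect univ MeasurableSet.univ univ MeasurableSet.univ
      have h2 := P_add _ _ ((stronglyMeasurable_const.indicator
        (MeasurableSet.univ.prod MeasurableSet.univ)).aestronglyMeasurable) h1 (P_smul (-1) _ ih)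
      convert h2 using 1
      ext p
      by_cases hp : p ∈ s <;> simp [hp]
    | iUnion t hd ht ih =>
      have P_part : ∀ N : ℕ, P ((⋃ i ∈ Finset.range N, t i).indicator fun _ => 1) ∧
          MeasurableSet (⋃ i ∈ Finset.range N, t i) := by
        intro N
        induction N with
        | zero => exact ⟨by simpa using P_rect ∅ MeasurableSet.empty ∅ MeasurableSet.empty, by simp⟩
        | succ N ihN =>
          refine ⟨?_, Finset.measurableSet_biUnion _ fun i _ => ht i⟩
          have h2 := P_add _ _ ((stronglyMeasurable_const.indicator ihN.2).aestronglyMeasurable)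
            ihN.1 (ih N)
          convert h2 using 1
          rw [Finset.range_add_one, Finset.set_biUnion_insert, union_comm]
          refine Set.indicator_union_of_disjoint ?_ _
          simp only [Set.disjoint_iUnion_left]
          intro i hi
          exact hd (by simp at hi; omega)
      have hU : MeasurableSet (⋃ i, t i) := MeasurableSet.iUnion ht
      refine P_lim _ (stronglyMeasurable_const.indicator hU).aestronglyMeasurable ?_
      intro δ hδ
      have hmono : Monotone fun N : ℕ => ⋃ i ∈ Finset.range N, t i := by
        intro a b hab
        refine Set.biUnion_subset_biUnion_left fun i hi => ?_
        have : i < a := by simpa using hi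
        simpa using this.trans_le hab
      have hU' : ⋃ N : ℕ, ⋃ i ∈ Finset.range N, t i = ⋃ i, t i := by
        ext p
        simp only [mem_iUnion, Finset.mem_range]
        exact ⟨fun ⟨N, i, _, hi⟩ => ⟨i, hi⟩, fun ⟨i, hi⟩ => ⟨i + 1, i, by omega, hi⟩⟩
      have hanti : Antitone fun N : ℕ => (⋃ i, t i) \ ⋃ i ∈ Finset.range N, t i :=
        fun a b hab => sdiff_subset_sdiff_right (hmono hab)
      have hlim := tendsto_measure_iInter_atTop (μ := m)
        (fun N => (hU.diff (P_part N).2).nullMeasurableSet) hanti ⟨0, measure_ne_top _ _⟩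
      have h0 : ⋂ N : ℕ, (⋃ i, t i) \ ⋃ i ∈ Finset.range N, t i = ∅ := by
        rw [← sdiff_iUnion, hU', sdiff_self]
      rw [h0, measure_empty] at hlim
      obtain ⟨N, hN⟩ := (hlim.eventually (gt_mem_nhds (pos_iff_ne_zero.2 hδ))).exists
      refine ⟨_, (P_part N).1, ?_,
        (stronglyMeasurable_const.indicator (P_part N).2).aestronglyMeasurable⟩
      refine lt_of_eq_of_lt ?_ hN
      rw [Function.comp_apply, ← lintegral_indicator_one (hU.diff (P_part N).2)]
      refine lintegral_congr fun p => ?_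
      have hsub : (⋃ i ∈ Finset.range N, t i) ⊆ ⋃ i, t i :=
        Set.iUnion₂_subset fun i _ => subset_iUnion t i
      by_cases h1 : p ∈ ⋃ i ∈ Finset.range N, t i
      · have h2 := hsub h1
        rw [Set.indicator_of_mem h1, Set.indicator_of_mem h2,
          Set.indicator_of_notMem (fun h => h.2 h1)]
        simp
      · by_cases h2 : p ∈ ⋃ i, t i
        · rw [Set.indicator_of_notMem h1, Set.indicator_of_mem h2,
            Set.indicator_of_mem (show p ∈ _ \ _ from ⟨h2, h1⟩)]
          simp
        · rw [Set.indicator_of_notMem h1, Set.indicator_of_notMem h2,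
            Set.indicator_of_notMem (fun h => h2 h.1)]
          simp
  have main : P F := by
    refine Integrable.induction (P := P) ?_ ?_ ?_ ?_ hF
    · intro c s hs _
      have := P_smul c _ (P_set s hs)
      convert this using 1
      ext p
      by_cases hp : p ∈ s <;> simp [hp]
    · intro f g _ hf hg h1 h2
      exact P_add f g hf.aestronglyMeasurable h1 h2
    · refine isClosed_of_closure_subset fun f hf => ?_
      refine P_lim _ (Lp.aestronglyMeasurable f) fun δ hδ => ?_
      rw [EMetric.mem_closure_iff] at hf
      obtain ⟨g, hg, hfg⟩ := hf δ (pos_iff_ne_zero.2 hδ)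
      refine ⟨g, hg, ?_, Lp.aestronglyMeasurable g⟩
      rw [edist_comm, Lp.edist_def, eLpNorm_one_eq_lintegral_enorm] at hfg
      exact hfg
    · intro f g hfg _ h1 δ hδ
      obtain ⟨S, hS, hC, hSd⟩ := h1 δ hδ
      refine ⟨S, hS, hC, lt_of_eq_of_lt (lintegral_congr_ae ?_) hSd⟩
      filter_upwards [hfg] with p hp
      rw [hp]
  exact main

/-- If `F(ω, t) = f(α_t ω)` is rectangular locally integrable then `T^# f` is unique almost
everywhere. -/
theorem IsTransfer.ae_eq {G Ω : Type*} [AddCommGroup G] [MeasurableSpace G] [MeasurableSpace Ω]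
    [AddAction G Ω] {h : Measure G} {μ : Measure Ω} [SigmaFinite h] [SigmaFinite μ]
    {T : (G → ℂ) → G → ℂ} {f g₁ g₂ : Ω → ℂ}
    (hf : ∀ (A : Set Ω) (B : Set G), MeasurableSet A → μ A < ∞ → MeasurableSet B → h B < ∞ →
      IntegrableOn (fun p : Ω × G => f (p.2 +ᵥ p.1)) (A ×ˢ B) (μ.prod h))
    (h₁ : IsTransfer h μ T f g₁) (h₂ : IsTransfer h μ T f g₂) : g₁ =ᵐ[μ] g₂ := by
  have key : ∀ A, MeasurableSet A → μ A < ∞ → ∫⁻ ω in A, ‖g₁ ω - g₂ ω‖ₑ ∂μ = 0 := by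
    intro A hA hμA
    by_contra hne
    set I := ∫⁻ ω in A, ‖g₁ ω - g₂ ω‖ₑ ∂μ with hI
    have hε : 0 < I / 2 := ENNReal.half_pos hne
    obtain ⟨A₁, B₁, δ₁, hA₁, hμA₁, hB₁, hhB₁, hδ₁, H₁⟩ := h₁.2 A hA hμA _ hε
    obtain ⟨A₂, B₂, δ₂, hA₂, hμA₂, hB₂, hhB₂, hδ₂, H₂⟩ := h₂.2 A hA hμA _ hε
    have hAu : μ (A₁ ∪ A₂) < ∞ := measure_union_lt_top hμA₁ hμA₂
    have hBu : h (B₁ ∪ B₂) < ∞ := measure_union_lt_top hhB₁ hhB₂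
    have : IsFiniteMeasure ((μ.prod h).restrict ((A₁ ∪ A₂) ×ˢ (B₁ ∪ B₂))) := by
      refine ⟨?_⟩
      rw [Measure.restrict_apply_univ, Measure.prod_prod]
      exact ENNReal.mul_lt_top hAu hBu
    obtain ⟨S, hS, ⟨C, hC⟩, hSd⟩ := exists_simpleFunc_approx _ _
      (hf _ _ (hA₁.union hA₂) hAu (hB₁.union hB₂) hBu) (min δ₁ δ₂) (lt_min hδ₁ hδ₂).ne'
    have hloc : ∀ ω, LocInt h (S ω) := fun ω =>
      ⟨(hS.comp measurable_prodMk_left).aestronglyMeasurable, fun B _ hB => by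
        calc ∫⁻ t in B, ‖S ω t‖ₑ ∂h ≤ ∫⁻ _ in B, C ∂h := lintegral_mono fun t => hC ω t
          _ < ∞ := by simpa using ENNReal.mul_lt_top (by simp) hB⟩
    have b₁ := H₁ S hloc ((lintegral_mono_set (prod_mono subset_union_left
      subset_union_left)).trans_lt (hSd.trans_le (min_le_left _ _)))
    have b₂ := H₂ S hloc ((lintegral_mono_set (prod_mono subset_union_right
      subset_union_right)).trans_lt (hSd.trans_le (min_le_right _ _)))
    have hTm : AEStronglyMeasurable (fun ω => T (S ω) 0) (μ.restrict A) :=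
      ((S.map fun u => T u 0).stronglyMeasurable).aestronglyMeasurable
    have : I < I / 2 + I / 2 := by
      calc I ≤ ∫⁻ ω in A, (‖T (S ω) 0 - g₁ ω‖ₑ + ‖T (S ω) 0 - g₂ ω‖ₑ) ∂μ := by
            refine lintegral_mono fun ω => ?_
            have e : g₁ ω - g₂ ω = (T (S ω) 0 - g₂ ω) - (T (S ω) 0 - g₁ ω) := by ring
            simp only [e]
            exact enorm_sub_le.trans_eq (add_comm _ _)
        _ = _ := lintegral_add_left' ((hTm.sub h₁.1.1.restrict).enorm) _
        _ < _ := ENNReal.add_lt_add b₁ b₂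
    rw [ENNReal.add_halves] at this
    exact lt_irrefl _ this
  have hz : ∀ n, g₁ =ᵐ[μ.restrict (spanningSets μ n)] g₂ := by
    intro n
    have := key _ (measurableSet_spanningSets μ n) (measure_spanningSets_lt_top μ n)
    replace this := (lintegral_eq_zero_iff' ((h₁.1.1.sub h₂.1.1).restrict.enorm)).1 this
    filter_upwards [this] with ω hω
    simpa [sub_eq_zero] using hω
  have := (ae_restrict_iUnion_iff (spanningSets μ) (fun ω => g₁ ω = g₂ ω)).2 hz
  rwa [iUnion_spanningSets, Measure.restrict_univ] at this

/-- The map `(ω, t) ↦ (t, α_t ω)` preserves the product measures. -/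
theorem measurePreserving_action {G Ω : Type*} [AddCommGroup G] [MeasurableSpace G]
    [MeasurableSpace Ω] [AddAction G Ω] [MeasurableVAdd₂ G Ω] (h : Measure G) (μ : Measure Ω)
    [SFinite h] [SFinite μ] [VAddInvariantMeasure G Ω μ] :
    MeasurePreserving (fun p : Ω × G => (p.2, p.2 +ᵥ p.1)) (μ.prod h) (h.prod μ) := by
  have h1 : MeasurePreserving (fun p : G × Ω => (id p.1, p.1 +ᵥ p.2)) (h.prod μ) (h.prod μ) :=
    (MeasurePreserving.id h).skew_product (g := fun (t : G) (ω : Ω) => t +ᵥ ω)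
      measurable_vadd (Eventually.of_forall fun t => (measurePreserving_vadd t μ).map_eq)
  exact h1.comp (Measure.measurePreserving_swap (μ := μ) (ν := h))

/-- For `f` in `L¹ + L^∞` the function `F(ω, t) = f(α_t ω)` is rectangular locally integrable. -/
theorem integrableOn_action {G Ω : Type*} [AddCommGroup G] [MeasurableSpace G]
    [MeasurableSpace Ω] [AddAction G Ω] [MeasurableVAdd₂ G Ω] (h : Measure G) (μ : Measure Ω)
    [SigmaFinite h] [SigmaFinite μ] [VAddInvariantMeasure G Ω μ] {f₁ f₂ : Ω → ℂ}
    (hf₁ : Integrable f₁ μ) (hf₂ : MemLp f₂ ∞ μ) (A : Set Ω) (B : Set G)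
    (hμA : μ A < ∞) (hB : MeasurableSet B) (hhB : h B < ∞) :
    IntegrableOn (fun p : Ω × G => (f₁ + f₂) (p.2 +ᵥ p.1)) (A ×ˢ B) (μ.prod h) := by
  have mp := measurePreserving_action h μ
  have i₁ : IntegrableOn (fun p : Ω × G => f₁ (p.2 +ᵥ p.1)) (A ×ˢ B) (μ.prod h) := by
    have hmp := mp.restrict_preimage (hB.prod MeasurableSet.univ)
    have : IsFiniteMeasure (h.restrict B) := ⟨by simpa using hhB⟩
    have hi : Integrable (fun q : G × Ω => f₁ q.2) ((h.prod μ).restrict (B ×ˢ univ)) := by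
      rw [← Measure.prod_restrict, Measure.restrict_univ]
      exact hf₁.comp_snd _
    have := hmp.integrable_comp_of_integrable hi
    exact IntegrableOn.mono_set (t := (fun p : Ω × G => (p.2, p.2 +ᵥ p.1)) ⁻¹' (B ×ˢ univ)) this
      fun p hp => ⟨hp.2, mem_univ _⟩
  have i₂ : IntegrableOn (fun p : Ω × G => f₂ (p.2 +ᵥ p.1)) (A ×ˢ B) (μ.prod h) := by
    have : IsFiniteMeasure ((μ.prod h).restrict (A ×ˢ B)) := by
      refine ⟨?_⟩
      rw [Measure.restrict_apply_univ, Measure.prod_prod]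
      exact ENNReal.mul_lt_top hμA hhB
    have h2 : MemLp (fun p : Ω × G => f₂ (p.2 +ᵥ p.1)) ∞ (μ.prod h) := by
      have q := Measure.quasiMeasurePreserving_snd (μ := h) (ν := μ)
      have h3 : MemLp (fun q : G × Ω => f₂ q.2) ∞ (h.prod μ) := by
        refine memLp_top_of_bound (hf₂.1.comp_quasiMeasurePreserving q)
          (eLpNormEssSup f₂ μ).toReal ?_
        have h4 := hf₂.2
        rw [eLpNorm_exponent_top] at h4
        filter_upwards [q.ae (enorm_ae_le_eLpNormEssSup f₂ μ)] with p hp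
        rw [← toReal_enorm]
        exact ENNReal.toReal_mono h4.ne hp
      exact h3.comp_measurePreserving mp
    exact (h2.restrict _).integrable le_top
  exact i₁.add i₂

/-- Joint measurability of a simple function with almost everywhere measurable values. -/
theorem aestronglyMeasurable_uncurry {G Ω : Type*} [MeasurableSpace G] [MeasurableSpace Ω]
    (h : Measure G) (μ : Measure Ω) [SFinite h] [SFinite μ] (S : SimpleFunc Ω (G → ℂ))
    (hS : ∀ ω, AEStronglyMeasurable (S ω) h) :
    AEStronglyMeasurable (fun p : Ω × G => S p.1 p.2) (μ.prod h) := by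
  classical
  set r : (G → ℂ) → G → ℂ := fun u => if H : AEStronglyMeasurable u h then H.mk u else 0 with hr
  have hrm : ∀ u, Measurable (r u) := by
    intro u
    by_cases H : AEStronglyMeasurable u h
    · simpa [hr, H] using H.stronglyMeasurable_mk.measurable
    · simpa [hr, H] using measurable_zero
  have hm : Measurable fun p : Ω × G => r (S p.1) p.2 :=
    (S.comp Prod.fst measurable_fst).measurable_bind (fun u p => r u p.2)
      fun u => (hrm u).comp measurable_snd
  refine ⟨_, hm.stronglyMeasurable, ?_⟩
  have hall : ∀ u ∈ S.range, ∀ᵐ p ∂(μ.prod h), u p.2 = r u p.2 := by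
    intro u hu
    obtain ⟨ω, rfl⟩ := SimpleFunc.mem_range.1 hu
    refine (Measure.quasiMeasurePreserving_snd (μ := μ) (ν := h)).ae (p := fun t => S ω t = r (S ω) t) ?_
    filter_upwards [(hS ω).ae_eq_mk] with t ht
    simpa [hr, hS ω] using ht
  filter_upwards [(Finset.eventually_all S.range).2 hall] with p hp
  exact hp _ (S.mem_range_self _)

/-- The transfer of a convolution operator exists, and it is given by the explicit formula
`T^# f(ω) = ∫ k(s) f(α_{-s} ω) ds`. -/
theorem isTransfer_convOp {G Ω : Type*} [AddCommGroup G] [TopologicalSpace G]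
    [IsTopologicalAddGroup G] [LocallyCompactSpace G] [T2Space G] [SecondCountableTopology G]
    [MeasurableSpace G] [BorelSpace G]
    [MeasurableSpace Ω] [AddAction G Ω] [MeasurableVAdd₂ G Ω] (h : Measure G) (μ : Measure Ω)
    [SigmaFinite μ] [h.IsAddHaarMeasure] [VAddInvariantMeasure G Ω μ]
    {k : G → ℂ} (hk : MemLp k ∞ h)
    (hk_supp : ∃ K : Set G, IsCompact K ∧ ∀ᵐ t ∂h, t ∉ K → k t = 0) {f : Ω → ℂ}
    (hf : ∀ (A : Set Ω) (B : Set G), MeasurableSet A → μ A < ∞ → MeasurableSet B → h B < ∞ →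
      IntegrableOn (fun p : Ω × G => f (p.2 +ᵥ p.1)) (A ×ˢ B) (μ.prod h))
    (hfm : AEStronglyMeasurable f μ) :
    IsTransfer h μ (convOp h k) f (fun ω => ∫ s, k s * f (-s +ᵥ ω) ∂h) := by
  obtain ⟨K, hK, hkK⟩ := hk_supp
  set M : ℝ≥0∞ := eLpNormEssSup k h with hM
  have hMtop : M < ∞ := by
    have := hk.2
    rwa [eLpNorm_exponent_top] at this
  have hkM : ∀ᵐ s ∂h, ‖k s‖ₑ ≤ M := enorm_ae_le_eLpNormEssSup k h
  set B : Set G := -K with hBdef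
  have hBc : IsCompact B := hK.neg
  have hBm : MeasurableSet B := hBc.measurableSet
  have hBh : h B < ∞ := hBc.measure_lt_top
  -- the pointwise bound for integrals against `k`
  have bound : ∀ u : G → ℂ, ∫⁻ s, ‖k s * u (-s)‖ₑ ∂h ≤ M * ∫⁻ t in B, ‖u t‖ₑ ∂h := by
    intro u
    calc ∫⁻ s, ‖k s * u (-s)‖ₑ ∂h ≤ ∫⁻ s, M * B.indicator (fun t => ‖u t‖ₑ) (-s) ∂h := by
          refine lintegral_mono_ae ?_
          filter_upwards [hkM, hkK] with s h1 h2
          by_cases hs : s ∈ K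
          · rw [Set.indicator_of_mem (by simpa [hBdef] using hs), enorm_mul]
            gcongr
          · simp [h2 hs]
      _ = M * ∫⁻ s, B.indicator (fun t => ‖u t‖ₑ) (-s) ∂h := lintegral_const_mul' _ _ hMtop.ne
      _ = M * ∫⁻ t in B, ‖u t‖ₑ ∂h := by
          rw [lintegral_neg_eq_self (fun t => B.indicator (fun t => ‖u t‖ₑ) t),
            lintegral_indicator hBm]
  have hqmp : Measure.QuasiMeasurePreserving (fun p : Ω × G => -p.2 +ᵥ p.1) (μ.prod h) μ := by
    have h1 : MeasurePreserving (fun p : Ω × G => (p.1, -p.2)) (μ.prod h) (μ.prod h) :=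
      (MeasurePreserving.id μ).prod (Measure.measurePreserving_neg h)
    exact (Measure.quasiMeasurePreserving_snd (μ := h) (ν := μ)).comp
      ((measurePreserving_action h μ).comp h1).quasiMeasurePreserving
  have hgm : AEStronglyMeasurable (fun ω => ∫ s, k s * f (-s +ᵥ ω) ∂h) μ := by
    refine AEStronglyMeasurable.integral_prod_right'
      (f := fun p : Ω × G => k p.2 * f (-p.2 +ᵥ p.1)) ?_
    exact (hk.1.comp_quasiMeasurePreserving Measure.quasiMeasurePreserving_snd).mul
      (hfm.comp_quasiMeasurePreserving hqmp)
  have hprod : ∀ A : Set Ω, MeasurableSet A → ∀ u : Ω × G → ℂ,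
      AEStronglyMeasurable u ((μ.prod h).restrict (A ×ˢ B)) →
      ∫⁻ ω in A, ∫⁻ t in B, ‖u (ω, t)‖ₑ ∂h ∂μ = ∫⁻ p in A ×ˢ B, ‖u p‖ₑ ∂(μ.prod h) := by
    intro A hA u hu
    rw [← Measure.prod_restrict] at hu ⊢
    exact (lintegral_prod _ hu.enorm).symm
  refine ⟨⟨hgm, fun A hA hμA => ?_⟩, fun A hA hμA ε hε => ?_⟩
  · have hi := hf A B hA hμA hBm hBh
    calc ∫⁻ ω in A, ‖∫ s, k s * f (-s +ᵥ ω) ∂h‖ₑ ∂μ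
        ≤ ∫⁻ ω in A, M * ∫⁻ t in B, ‖f (t +ᵥ ω)‖ₑ ∂h ∂μ :=
          lintegral_mono fun ω => (enorm_integral_le_lintegral_enorm _).trans
            (bound fun t => f (t +ᵥ ω))
      _ = M * ∫⁻ ω in A, ∫⁻ t in B, ‖f (t +ᵥ ω)‖ₑ ∂h ∂μ := lintegral_const_mul' _ _ hMtop.ne
      _ = M * ∫⁻ p in A ×ˢ B, ‖f (p.2 +ᵥ p.1)‖ₑ ∂(μ.prod h) := by
          rw [hprod A hA (fun p => f (p.2 +ᵥ p.1)) hi.1]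
      _ < ∞ := ENNReal.mul_lt_top hMtop hi.2
  · have hi := hf A B hA hμA hBm hBh
    refine ⟨A, B, ε / (M + 1), hA, hμA, hBm, hBh,
      ENNReal.div_pos hε.ne' (by simpa using hMtop.ne), fun S hS hd => ?_⟩
    have hfω : ∀ᵐ ω ∂(μ.restrict A), IntegrableOn (fun t => f (t +ᵥ ω)) B h := by
      have hi' := hi
      rw [IntegrableOn, ← Measure.prod_restrict] at hi'
      exact hi'.prod_right_ae
    have hint : ∀ u : G → ℂ, IntegrableOn u B h → Integrable (fun s => k s * u (-s)) h := by
      intro u hu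
      have h0 : Integrable (fun s => k s * B.indicator u (-s)) h :=
        Integrable.bdd_mul (((integrable_indicator_iff hBm).2 hu).comp_neg) hk.1
          (c := M.toReal) (by
            filter_upwards [hkM] with s hs
            rw [← toReal_enorm]
            exact ENNReal.toReal_mono hMtop.ne hs)
      refine h0.congr ?_
      filter_upwards [hkK] with s h2
      by_cases hs : s ∈ K
      · rw [Set.indicator_of_mem (by simpa [hBdef] using hs)]
      · simp [h2 hs]
    have hSB : ∀ ω, IntegrableOn (S ω) B h := fun ω =>
      ⟨(hS ω).1.restrict, (hS ω).2 B hBm hBh⟩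
    calc ∫⁻ ω in A, ‖convOp h k (S ω) 0 - ∫ s, k s * f (-s +ᵥ ω) ∂h‖ₑ ∂μ
        ≤ ∫⁻ ω in A, M * ∫⁻ t in B, ‖S ω t - f (t +ᵥ ω)‖ₑ ∂h ∂μ := by
          refine lintegral_mono_ae ?_
          filter_upwards [hfω] with ω hω
          have e : convOp h k (S ω) 0 - ∫ s, k s * f (-s +ᵥ ω) ∂h =
              ∫ s, k s * (S ω (-s) - f (-s +ᵥ ω)) ∂h := by
            simp only [mul_sub]
            rw [integral_sub (hint _ (hSB ω)) (hint (fun t => f (t +ᵥ ω)) hω)]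
            simp [convOp, convolution_def]
          rw [e]
          exact (enorm_integral_le_lintegral_enorm _).trans
            (bound fun t => S ω t - f (t +ᵥ ω))
      _ = M * ∫⁻ ω in A, ∫⁻ t in B, ‖S ω t - f (t +ᵥ ω)‖ₑ ∂h ∂μ :=
          lintegral_const_mul' _ _ hMtop.ne
      _ ≤ M * ∫⁻ p in A ×ˢ B, ‖S p.1 p.2 - f (p.2 +ᵥ p.1)‖ₑ ∂(μ.prod h) := by
          gcongr
          exact (hprod A hA (fun p => S p.1 p.2 - f (p.2 +ᵥ p.1))
            ((aestronglyMeasurable_uncurry h μ S fun ω => (hS ω).1).restrict.sub hi.1)).le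
      _ ≤ (M + 1) * ∫⁻ p in A ×ˢ B, ‖S p.1 p.2 - f (p.2 +ᵥ p.1)‖ₑ ∂(μ.prod h) := by
          gcongr
          exact le_self_add
      _ < ε := by
          rw [mul_comm]
          exact (ENNReal.lt_div_iff_mul_lt (Or.inl (by simp))
            (Or.inl (by simpa using hMtop.ne))).1 hd

/-- The transferred operator of a convolution operator satisfies the defining property of `T^#`
and is given by the explicit formula. -/
theorem transfer_convOp_ae_eq {G Ω : Type*} [AddCommGroup G] [TopologicalSpace G]
    [IsTopologicalAddGroup G] [LocallyCompactSpace G] [T2Space G] [SecondCountableTopology G]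
    [MeasurableSpace G] [BorelSpace G]
    [MeasurableSpace Ω] [AddAction G Ω] [MeasurableVAdd₂ G Ω] (h : Measure G) (μ : Measure Ω)
    [SigmaFinite μ] [h.IsAddHaarMeasure] [VAddInvariantMeasure G Ω μ]
    {k : G → ℂ} (hk : MemLp k ∞ h)
    (hk_supp : ∃ K : Set G, IsCompact K ∧ ∀ᵐ t ∂h, t ∉ K → k t = 0) {f f₁ f₂ : Ω → ℂ}
    (hf₁ : Integrable f₁ μ) (hf₂ : MemLp f₂ ∞ μ) (hf : f = f₁ + f₂) :
    IsTransfer h μ (convOp h k) f (transfer h μ (convOp h k) f) ∧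
      transfer h μ (convOp h k) f =ᵐ[μ] fun ω => ∫ s, k s * f (-s +ᵥ ω) ∂h := by
  subst hf
  have hloc := fun A B (_ : MeasurableSet A) hμA hB hhB =>
    integrableOn_action h μ hf₁ hf₂ A B hμA hB hhB
  have hT := isTransfer_convOp h μ hk hk_supp hloc (hf₁.1.add hf₂.1)
  have hex : ∃ g, IsTransfer h μ (convOp h k) (f₁ + f₂) g := ⟨_, hT⟩
  have hc : IsTransfer h μ (convOp h k) (f₁ + f₂) (transfer h μ (convOp h k) (f₁ + f₂)) := by
    rw [transfer, dif_pos hex]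
    exact hex.choose_spec
  exact ⟨hc, hc.ae_eq hloc hT⟩

end

end Transfer

open Transfer

/-! This is a Banach principle argument: a maximal inequality together with a.e. convergence on a
dense class gives a.e. convergence everywhere. After `transfer_ae_eq_average` the operators become
explicit averages `∫ k n s * f (-s +ᵥ ω)`.

Convergence comes for free on functions that are already averages. If `φ` is an integrable kernel
with support of finite measure and `u` is bounded, associativity of convolution turns the `k
n`-average of the `φ`-average of `u` into the `k n * φ`-average of `u` (`average_average`). Weak
convergence of `k n * φ`, tested against the bounded function `s ↦ u (-s +ᵥ ω)`, then gives
convergence at every `ω` (`ConvergesWeaklyL1.exists_tendsto_average`).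

These functions approximate indicators: by point-weak* continuity, averaging `χ_E` over a small
neighbourhood of `0` moves it little in `L¹`, and by at most `1` pointwise, hence little in the
Orlicz space (`exists_average_indicator_approx`, `lintegral_young_le`). The maximal inequality, in
the form `AverageConverges.of_approx`, is applied twice: to pass from averages to indicators and,
after taking linear combinations, from simple functions to all of `X`. The `Δ₂` condition makes
integrable simple functions dense (`MemOrlicz.exists_simpleFunc`). -/

namespace Transfer

/-! ### Young's functions under the global `Δ₂` condition -/

section Young

variable {Φ : ℝ≥0 → ℝ≥0∞}

theorem IsYoungFunction.map_mul_le (hΦ : IsYoungFunction Φ) {a : ℝ≥0} (ha : a ≤ 1) (x : ℝ≥0) :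
    Φ (a * x) ≤ a * Φ x := by
  have := hΦ.convex.2 (mem_univ x) (mem_univ 0) (zero_le (a := a)) (zero_le (a := 1 - a))
    (add_tsub_cancel_of_le ha)
  simpa [hΦ.map_zero, ENNReal.smul_def] using this

theorem Delta2.map_two_pow_mul_le {K : ℝ≥0} (hK : ∀ x, Φ (2 * x) ≤ K * Φ x) (n : ℕ) (x : ℝ≥0) :
    Φ (2 ^ n * x) ≤ K ^ n * Φ x := by
  induction n with
  | zero => simp
  | succ n ih =>
    calc Φ (2 ^ (n + 1) * x) = Φ (2 * (2 ^ n * x)) := by ring_nf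
      _ ≤ K * Φ (2 ^ n * x) := hK _
      _ ≤ K * (K ^ n * Φ x) := by gcongr
      _ = K ^ (n + 1) * Φ x := by ring

theorem exists_le_two_pow_mul {x : ℝ≥0} (hx : 0 < x) (y : ℝ≥0) : ∃ n : ℕ, y ≤ 2 ^ n * x := by
  obtain ⟨n, hn⟩ := pow_unbounded_of_one_lt (y / x) (one_lt_two (α := ℝ≥0))
  exact ⟨n, by rw [div_lt_iff₀ hx] at hn; exact hn.le⟩

/-- Repeated doubling carries finiteness from one positive point to arbitrarily large ones. In the
same way, a zero at a positive point would spread to all of `[0, ∞)`, against `tendsto_top`; this is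
`map_ne_zero`. -/
theorem IsYoungFunction.ne_top (hΦ : IsYoungFunction Φ) (hΔ : Delta2 Φ) (y : ℝ≥0) : Φ y ≠ ∞ := by
  obtain ⟨K, -, hK⟩ := hΔ
  obtain ⟨x, hx, hxt⟩ := hΦ.exists_ne_top
  obtain ⟨n, hn⟩ := exists_le_two_pow_mul hx y
  exact ne_top_of_le_ne_top (by finiteness)
    ((hΦ.mono hn).trans (Delta2.map_two_pow_mul_le hK n x))

theorem IsYoungFunction.map_ne_zero (hΦ : IsYoungFunction Φ) (hΔ : Delta2 Φ) {x : ℝ≥0}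
    (hx : 0 < x) : Φ x ≠ 0 := by
  intro h0
  obtain ⟨K, -, hK⟩ := hΔ
  obtain ⟨y, hy⟩ := (hΦ.tendsto_top.eventually (lt_mem_nhds ENNReal.zero_lt_top)).exists
  obtain ⟨n, hn⟩ := exists_le_two_pow_mul hx y
  have := (hΦ.mono hn).trans (Delta2.map_two_pow_mul_le hK n x)
  rw [h0, mul_zero] at this
  exact this.not_gt hy

theorem IsYoungFunction.tendsto_zero (hΦ : IsYoungFunction Φ) (hΔ : Delta2 Φ) :
    Tendsto Φ (𝓝 0) (𝓝 0) := by
  have h1 : Tendsto (fun a : ℝ≥0 => (a : ℝ≥0∞) * Φ 1) (𝓝 0) (𝓝 0) := by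
    have := ENNReal.Tendsto.mul_const (b := Φ 1)
      (ENNReal.continuous_coe.tendsto (0 : ℝ≥0)) (Or.inr (hΦ.ne_top hΔ 1))
    simpa using this
  refine tendsto_of_tendsto_of_tendsto_of_le_of_le' tendsto_const_nhds h1
    (Eventually.of_forall fun _ => zero_le) ?_
  filter_upwards [Iic_mem_nhds (zero_lt_one (α := ℝ≥0))] with a ha
  simpa using hΦ.map_mul_le ha 1

end Young

/-! ### The Orlicz space: embedding in `L¹ + L^∞` and density of simple functions -/

/-- The sum `L¹ + L^∞`. -/
def MemSum {Ω : Type*} [MeasurableSpace Ω] (μ : Measure Ω) (f : Ω → ℂ) : Prop :=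
  ∃ f₁ f₂ : Ω → ℂ, Integrable f₁ μ ∧ MemLp f₂ ∞ μ ∧ f = f₁ + f₂

section Orlicz

variable {Ω : Type*} [MeasurableSpace Ω] {μ : Measure Ω}

theorem MemSum.aestronglyMeasurable {f : Ω → ℂ} (hf : MemSum μ f) : AEStronglyMeasurable f μ := by
  obtain ⟨f₁, f₂, h1, h2, rfl⟩ := hf
  exact h1.1.add h2.1

theorem MemSum.add {f g : Ω → ℂ} (hf : MemSum μ f) (hg : MemSum μ g) : MemSum μ (f + g) := by
  obtain ⟨f₁, f₂, h1, h2, rfl⟩ := hf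
  obtain ⟨g₁, g₂, h3, h4, rfl⟩ := hg
  exact ⟨f₁ + g₁, f₂ + g₂, h1.add h3, h2.add h4, by abel⟩

theorem MemSum.const_smul {f : Ω → ℂ} (hf : MemSum μ f) (c : ℂ) : MemSum μ (c • f) := by
  obtain ⟨f₁, f₂, h1, h2, rfl⟩ := hf
  exact ⟨c • f₁, c • f₂, h1.smul c, h2.const_smul c, smul_add _ _ _⟩

theorem MemSum.sub {f g : Ω → ℂ} (hf : MemSum μ f) (hg : MemSum μ g) : MemSum μ (f - g) := by
  simpa [sub_eq_add_neg] using hf.add (hg.const_smul (-1))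

theorem _root_.MeasureTheory.Integrable.memSum {f : Ω → ℂ} (hf : Integrable f μ) : MemSum μ f :=
  ⟨f, 0, hf, MemLp.zero, by simp⟩

theorem _root_.MeasureTheory.MemLp.memSum {f : Ω → ℂ} (hf : MemLp f ∞ μ) : MemSum μ f :=
  ⟨0, f, integrable_zero _ _ _, hf, by simp⟩

variable {Φ : ℝ≥0 → ℝ≥0∞}

theorem luxemburgNorm_le {f : Ω → ℂ} {k : ℝ≥0} (hk : 0 < k)
    (h : ∫⁻ ω, Φ (k * ‖f ω‖₊) ∂μ ≤ 1) : luxemburgNorm μ Φ f ≤ (k : ℝ≥0∞)⁻¹ :=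
  iInf_le_of_le k (iInf_le_of_le hk (iInf_le_of_le h le_rfl))

/-- Finiteness of the norm supplies a single scale `k₀` with finite modular; doubling it past `k`
costs only a factor `K ^ n`. Finiteness at every scale is what permits dominated convergence in the
density argument. -/
theorem MemOrlicz.lintegral_lt_top (hΦ : IsYoungFunction Φ) (hΔ : Delta2 Φ) {f : Ω → ℂ}
    (hf : MemOrlicz μ Φ f) (k : ℝ≥0) : ∫⁻ ω, Φ (k * ‖f ω‖₊) ∂μ < ∞ := by
  have h := hf.2
  simp only [luxemburgNorm, iInf_lt_iff] at h
  obtain ⟨k₀, hk₀, h1, -⟩ := h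
  obtain ⟨K, -, hK⟩ := hΔ
  obtain ⟨n, hn⟩ := exists_le_two_pow_mul hk₀ k
  calc ∫⁻ ω, Φ (k * ‖f ω‖₊) ∂μ ≤ ∫⁻ ω, K ^ n * Φ (k₀ * ‖f ω‖₊) ∂μ := by
        refine lintegral_mono fun ω => ?_
        refine le_trans (hΦ.mono ?_) (Delta2.map_two_pow_mul_le hK n (k₀ * ‖f ω‖₊))
        rw [← mul_assoc]
        gcongr
    _ = K ^ n * ∫⁻ ω, Φ (k₀ * ‖f ω‖₊) ∂μ := lintegral_const_mul' _ _ (by finiteness)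
    _ ≤ K ^ n * 1 := by gcongr
    _ < ∞ := by rw [mul_one]; finiteness

/-- Over an Orlicz function with the `Δ₂` condition, the Orlicz space is contained
in `L¹ + L^∞`. -/
theorem MemOrlicz.memSum (hΦ : IsYoungFunction Φ) (hΔ : Delta2 Φ) {f : Ω → ℂ}
    (hf : MemOrlicz μ Φ f) : MemSum μ f := by
  set s : Set Ω := {ω | ‖f ω‖₊ ≤ 1}
  have hs : NullMeasurableSet s μ := nullMeasurableSet_le hf.1.nnnorm.aemeasurable aemeasurable_const
  have h0 := hΦ.map_ne_zero hΔ one_pos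
  have ht := hΦ.ne_top hΔ 1
  refine ⟨sᶜ.indicator f, s.indicator f, ⟨hf.1.indicator₀ hs.compl, ?_⟩,
    memLp_top_of_bound (hf.1.indicator₀ hs) 1 (Eventually.of_forall fun ω => ?_),
    (indicator_compl_add_self s f).symm⟩
  · calc ∫⁻ ω, ‖sᶜ.indicator f ω‖ₑ ∂μ ≤ ∫⁻ ω, (Φ 1)⁻¹ * Φ (1 * ‖f ω‖₊) ∂μ := by
          refine lintegral_mono fun ω => ?_
          by_cases hω : ω ∈ s
          · simp [hω]
          have hx : 1 < ‖f ω‖₊ := not_le.1 hω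
          have hx0 : ‖f ω‖₊ ≠ 0 := (zero_lt_one.trans hx).ne'
          -- Scaling `‖f ω‖` down to `1` gives `Φ 1 ≤ Φ ‖f ω‖ / ‖f ω‖`, so the part of `f` above
          -- height `1` is dominated by `Φ ‖f‖ / Φ 1`.
          have h1 := hΦ.map_mul_le (inv_le_one_of_one_le₀ hx.le) ‖f ω‖₊
          rw [inv_mul_cancel₀ hx0, ENNReal.coe_inv hx0] at h1
          rw [Set.indicator_of_mem hω, one_mul, mul_comm, ← div_eq_mul_inv,
            ENNReal.le_div_iff_mul_le (Or.inl h0) (Or.inl ht)]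
          calc ‖f ω‖ₑ * Φ 1 ≤ ‖f ω‖ₑ * ((‖f ω‖₊ : ℝ≥0∞)⁻¹ * Φ ‖f ω‖₊) := by gcongr
            _ = Φ ‖f ω‖₊ := by
              rw [← mul_assoc, enorm_eq_nnnorm, ENNReal.mul_inv_cancel (by simpa using hx0)
                ENNReal.coe_ne_top, one_mul]
      _ = (Φ 1)⁻¹ * ∫⁻ ω, Φ (1 * ‖f ω‖₊) ∂μ := lintegral_const_mul' _ _ (by simpa using h0)
      _ < ∞ := ENNReal.mul_lt_top (by simpa using h0.bot_lt) (hf.lintegral_lt_top hΦ hΔ 1)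
  · by_cases hω : ω ∈ s
    · rw [Set.indicator_of_mem hω]
      exact_mod_cast hω
    · simp [hω]

/-- Integrable simple functions are dense in the Orlicz space. -/
theorem MemOrlicz.exists_simpleFunc (hΦ : IsYoungFunction Φ) (hΔ : Delta2 Φ) {f : Ω → ℂ}
    (hf : MemOrlicz μ Φ f) (k : ℝ≥0) :
    ∃ S : SimpleFunc Ω ℂ, Integrable S μ ∧ ∫⁻ ω, Φ (k * ‖f ω - S ω‖₊) ∂μ ≤ 1 := by
  set f' := hf.1.mk f
  have hm : Measurable f' := hf.1.stronglyMeasurable_mk.measurable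
  have hff' : f =ᵐ[μ] f' := hf.1.ae_eq_mk
  have hfin : ∀ k : ℝ≥0, ∫⁻ ω, Φ (k * ‖f' ω‖₊) ∂μ < ∞ := by
    intro k
    refine lt_of_eq_of_lt (lintegral_congr_ae ?_) (hf.lintegral_lt_top hΦ hΔ k)
    filter_upwards [hff'] with ω hω
    rw [hω]
  set S : ℕ → SimpleFunc Ω ℂ := SimpleFunc.approxOn f' hm univ 0 (mem_univ _)
  -- Dominated convergence: approximation with base point `0` never has an error larger than `‖f'‖`,
  -- and `Φ` is continuous at `0`.
  have hlim : Tendsto (fun n => ∫⁻ ω, Φ (k * ‖f' ω - S n ω‖₊) ∂μ) atTop (𝓝 0) := by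
    have := tendsto_lintegral_of_dominated_convergence (μ := μ)
      (F := fun n ω => Φ (k * ‖f' ω - S n ω‖₊)) (f := fun _ => 0)
      (fun ω => Φ (k * ‖f' ω‖₊))
      (fun n => hΦ.mono.measurable.comp (by fun_prop))
      (fun n => Eventually.of_forall fun ω => ?_) (hfin k).ne
      (Eventually.of_forall fun ω => ?_)
    · simpa using this
    · refine hΦ.mono ?_
      gcongr
      have := SimpleFunc.edist_approxOn_le hm (mem_univ (0 : ℂ)) ω n
      rw [edist_comm, edist_eq_enorm_sub, edist_comm, edist_eq_enorm_sub, sub_zero] at this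
      simpa [enorm_eq_nnnorm] using this
    · refine (hΦ.tendsto_zero hΔ).comp ?_
      have h1 : Tendsto (fun n => S n ω) atTop (𝓝 (f' ω)) :=
        SimpleFunc.tendsto_approxOn hm (mem_univ _) (by simp)
      have h2 := ((tendsto_const_nhds (x := f' ω)).sub h1).nnnorm.const_mul k
      simpa using h2
  obtain ⟨n, hn⟩ := (hlim.eventually (ge_mem_nhds zero_lt_one)).exists
  refine ⟨S n, ?_, ?_⟩
  · rw [SimpleFunc.integrable_iff]
    intro y hy
    have hy' : 0 < ‖y‖₊ := by simpa using hy
    have h0 := hΦ.map_ne_zero hΔ hy'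
    -- Markov's inequality bounds the level set of `y ≠ 0`: there `‖y‖ ≤ 2 * ‖f'‖`, and the modular
    -- of `2 * f'` is finite.
    refine lt_of_mul_lt_mul_left' (a := Φ ‖y‖₊) ?_
    rw [ENNReal.mul_top h0]
    calc Φ ‖y‖₊ * μ (S n ⁻¹' {y}) ≤ Φ ‖y‖₊ * μ {ω | Φ ‖y‖₊ ≤ Φ (2 * ‖f' ω‖₊)} := by
          gcongr
          intro ω hω
          have hω' : S n ω = y := hω
          have := SimpleFunc.norm_approxOn_zero_le hm (mem_univ _) ω n
          change ‖S n ω‖ ≤ _ at this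
          rw [hω', ← two_mul] at this
          exact hΦ.mono (by exact_mod_cast this)
      _ ≤ ∫⁻ ω, Φ (2 * ‖f' ω‖₊) ∂μ :=
          mul_meas_ge_le_lintegral (hΦ.mono.measurable.comp (by fun_prop)) _
      _ < ∞ := hfin 2
  · refine (lintegral_congr_ae ?_).trans_le hn
    filter_upwards [hff'] with ω hω
    rw [hω]

/-- In the Orlicz space, a bounded function of small `L¹` norm has small norm. -/
theorem lintegral_young_le (hΦ : IsYoungFunction Φ) {f : Ω → ℂ} (hb : ∀ ω, ‖f ω‖ ≤ 1)
    (k : ℝ≥0) (hk : Φ k ≠ ∞) : ∫⁻ ω, Φ (k * ‖f ω‖₊) ∂μ ≤ Φ k * ∫⁻ ω, ‖f ω‖ₑ ∂μ := by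
  rw [← lintegral_const_mul' _ _ hk]
  refine lintegral_mono fun ω => ?_
  rw [mul_comm k, mul_comm (Φ k)]
  exact hΦ.map_mul_le (hb ω) k

/-- The strict inequality leaves room for an admissible level `r < s`, so it does not matter whether
the infimum defining the rearrangement is attained. -/
theorem measure_lt_le_of_rearrangement_lt {u : Ω → ℝ≥0∞} {s t : ℝ≥0∞}
    (h : rearrangement μ u t < s) : μ {ω | s < u ω} ≤ t := by
  obtain ⟨r, hr, hrs⟩ := sInf_lt_iff.1 h
  exact (measure_mono fun ω hω => lt_trans hrs hω).trans hr

end Orlicz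

end Transfer

namespace Transfer

/-! ### Continuity of the action, and averages along orbits -/

section Action

set_option linter.unusedSectionVars false

variable {G Ω : Type*} [AddCommGroup G] [TopologicalSpace G] [IsTopologicalAddGroup G]
  [LocallyCompactSpace G] [T2Space G] [SecondCountableTopology G] [MeasurableSpace G]
  [BorelSpace G] {h : Measure G} [h.IsAddHaarMeasure]
  [MeasurableSpace Ω] {μ : Measure Ω} [SigmaFinite μ]
  [AddAction G Ω] [MeasurableVAdd₂ G Ω] [VAddInvariantMeasure G Ω μ]

/-- A point-weak* continuous action moves sets of finite measure continuously in `L¹`. -/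
theorem IsPointWeakStarContinuous.tendsto_lintegral_indicator
    (hcont : IsPointWeakStarContinuous G μ) {E : Set Ω} (hE : MeasurableSet E) (hμE : μ E < ∞) :
    Tendsto (fun t : G => ∫⁻ ω, ‖E.indicator (1 : Ω → ℂ) ω - E.indicator 1 (t +ᵥ ω)‖ₑ ∂μ)
      (𝓝 0) (𝓝 0) := by
  set e : Ω → ℂ := E.indicator 1
  have hem : Measurable e := measurable_one.indicator hE
  have he : Integrable e μ := (integrable_indicator_iff hE).2 (integrableOn_const hμE.ne)
  have he1 : ∀ ω, ‖e ω‖ ≤ 1 := fun ω => by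
    by_cases hω : ω ∈ E <;> simp [e, hω]
  have het : ∀ t : G, Integrable (fun ω => e (t +ᵥ ω)) μ := fun t =>
    (measurePreserving_vadd t μ).integrable_comp_of_integrable he
  have heet : ∀ t : G, Integrable (fun ω => e (t +ᵥ ω) * e ω) μ := fun t =>
    he.bdd_mul (het t).1 (c := 1) (Eventually.of_forall fun ω => he1 _)
  have hsq : ∀ ω, e ω * e ω = e ω := fun ω => by
    by_cases hω : ω ∈ E <;> simp [e, hω]
  have hc := hcont e (memLp_top_of_bound hem.aestronglyMeasurable 1 (Eventually.of_forall he1)) e he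
  -- For values in `{0, 1}` one has `|a - b| = a + b - 2ab`. By invariance of `μ` the first two
  -- terms have equal integrals, and the cross term is the pairing of `χ_E ∈ L^∞` with `χ_E ∈ L¹`,
  -- continuous in `t` by hypothesis. At `t = 0` everything cancels, as `e * e = e`.
  have key : ∀ t : G, ∫⁻ ω, ‖e ω - e (t +ᵥ ω)‖ₑ ∂μ =
      ENNReal.ofReal (2 * ∫ ω, e ω ∂μ - 2 * ∫ ω, e (t +ᵥ ω) * e ω ∂μ).re := by
    intro t
    rw [← ofReal_integral_norm_eq_lintegral_enorm (f := fun ω => e ω - e (t +ᵥ ω))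
      (he.sub (het t))]
    congr 1
    have h1 : ∀ ω, ((‖e ω - e (t +ᵥ ω)‖ : ℝ) : ℂ) =
        e ω + e (t +ᵥ ω) - 2 * (e (t +ᵥ ω) * e ω) := by
      intro ω
      by_cases h1 : ω ∈ E <;> by_cases h2 : t +ᵥ ω ∈ E <;> norm_num [e, h1, h2]
    have h2 : ∫ ω, e (t +ᵥ ω) ∂μ = ∫ ω, e ω ∂μ := integral_vadd_eq_self e
    rw [← Complex.ofReal_re (∫ ω, ‖e ω - e (t +ᵥ ω)‖ ∂μ), ← integral_complex_ofReal]
    simp only [h1]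
    rw [integral_sub (f := fun ω => e ω + e (t +ᵥ ω)) (he.add (het t)) ((heet t).const_mul 2),
      integral_add he (het t),
      integral_const_mul, h2, two_mul (∫ ω, e ω ∂μ)]
  simp only [key]
  have hlim := ENNReal.continuous_ofReal.tendsto _ |>.comp
    ((Complex.continuous_re.tendsto _).comp
      ((hc.tendsto 0).const_mul 2 |>.const_sub (2 * ∫ ω, e ω ∂μ)))
  simpa [hsq, Function.comp_def] using hlim

/-- The transfer of the convolution operator with kernel `k`, as an explicit integral. -/
noncomputable def average (h : Measure G) (k : G → ℂ) (f : Ω → ℂ) (ω : Ω) : ℂ :=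
  ∫ s, k s * f (-s +ᵥ ω) ∂h

/-- The kernel `φ` is the normalized indicator of a compact neighbourhood of `0` on which
translation moves `χ_E` by at most `δ` in `L¹`. The error is a mean of differences of indicator
values, hence at most `1` pointwise, and Tonelli bounds its `L¹` norm. Both bounds are needed to
control it in the Orlicz space. -/
theorem exists_average_indicator_approx (hcont : IsPointWeakStarContinuous G μ) {E : Set Ω}
    (hE : MeasurableSet E) (hμE : μ E < ∞) {δ : ℝ≥0∞} (hδ : 0 < δ) :
    ∃ φ : G → ℂ, Integrable φ h ∧ h (Function.support φ) < ∞ ∧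
      (∀ ω, ‖E.indicator 1 ω - average h φ (E.indicator 1) ω‖ ≤ 1) ∧
      ∫⁻ ω, ‖E.indicator 1 ω - average h φ (E.indicator 1) ω‖ₑ ∂μ ≤ δ := by
  have hlim := (hcont.tendsto_lintegral_indicator hE hμE).comp
    (show Tendsto (fun s : G => -s) (𝓝 0) (𝓝 0) by simpa using (continuous_neg.tendsto (0 : G)))
  set e : Ω → ℂ := E.indicator 1
  have hem : Measurable e := measurable_one.indicator hE
  obtain ⟨K, hK0, hKs, hK⟩ := local_compact_nhds (hlim.eventually (ge_mem_nhds hδ))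
  have hKm : MeasurableSet K := hK.measurableSet
  have hKt : h K < ∞ := hK.measure_lt_top
  -- Haar measure is positive on neighbourhoods and finite on compact sets, so `φ` can be normalized
  -- to have integral `1`.
  have hK0 : 0 < h.real K := ENNReal.toReal_pos (Measure.measure_pos_of_mem_nhds h hK0).ne' hKt.ne
  set φ : G → ℂ := K.indicator fun _ => ((h.real K)⁻¹ : ℂ)
  have hφm : Measurable φ := measurable_const.indicator hKm
  have hφ : Integrable φ h := (integrable_indicator_iff hKm).2 (integrableOn_const hKt.ne)
  have hφ1 : ∫ s, φ s ∂h = 1 := by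
    have : (h.real K : ℂ) ≠ 0 := by exact_mod_cast hK0.ne'
    simp [φ, integral_indicator hKm, this]
  have hφn : ∫ s, ‖φ s‖ ∂h = 1 := by
    simp only [φ, norm_indicator_eq_indicator_norm]
    simp [integral_indicator hKm, hK0.ne', abs_of_pos hK0]
  have hφe : ∫⁻ s, ‖φ s‖ₑ ∂h = 1 := by
    rw [← ofReal_integral_norm_eq_lintegral_enorm hφ, hφn, ENNReal.ofReal_one]
  have hb : ∀ ω ω', ‖e ω - e ω'‖ ≤ 1 := fun ω ω' => by
    by_cases h1 : ω ∈ E <;> by_cases h2 : ω' ∈ E <;> simp [e, h1, h2]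
  have he1 : ∀ ω, ‖e ω‖ ≤ 1 := fun ω => by
    by_cases hω : ω ∈ E <;> simp [e, hω]
  have hrep : ∀ ω, e ω - average h φ e ω = ∫ s, φ s * (e ω - e (-s +ᵥ ω)) ∂h := by
    intro ω
    have hm : Measurable fun s : G => e (-s +ᵥ ω) := hem.comp (by fun_prop)
    simp only [mul_sub]
    rw [integral_sub (hφ.mul_const _)
      (hφ.mul_bdd (c := 1) hm.aestronglyMeasurable (Eventually.of_forall fun s => he1 _)),
      integral_mul_const, hφ1, one_mul]
    rfl
  refine ⟨φ, hφ, (measure_mono Set.support_indicator_subset).trans_lt hKt, fun ω => ?_, ?_⟩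
  · rw [hrep, ← hφn]
    refine norm_integral_le_of_norm_le hφ.norm (Eventually.of_forall fun s => ?_)
    rw [norm_mul]
    exact mul_le_of_le_one_right (norm_nonneg _) (hb _ _)
  · calc ∫⁻ ω, ‖e ω - average h φ e ω‖ₑ ∂μ
        ≤ ∫⁻ ω, ∫⁻ s, ‖φ s‖ₑ * ‖e ω - e (-s +ᵥ ω)‖ₑ ∂h ∂μ := by
          refine lintegral_mono fun ω => ?_
          rw [hrep]
          refine (enorm_integral_le_lintegral_enorm _).trans_eq ?_
          simp only [enorm_mul]
      _ = ∫⁻ s, ∫⁻ ω, ‖φ s‖ₑ * ‖e ω - e (-s +ᵥ ω)‖ₑ ∂μ ∂h := by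
          refine lintegral_lintegral_swap (Measurable.aemeasurable ?_)
          have : Measurable fun p : Ω × G => -p.2 +ᵥ p.1 := by fun_prop
          exact ((hφm.comp measurable_snd).enorm).mul
            (((hem.comp measurable_fst).sub (hem.comp this)).enorm)
      _ ≤ ∫⁻ s, ‖φ s‖ₑ * δ ∂h := by
          refine lintegral_mono fun s => ?_
          rw [lintegral_const_mul' _ _ enorm_ne_top]
          by_cases hs : s ∈ K
          · gcongr
            exact hKs hs
          · simp [φ, hs]
      _ = δ := by
          rw [lintegral_mul_const _ hφm.enorm, hφe, one_mul]

/-- Along the orbit of `ω`, with `H t = u (t +ᵥ ω)`, an average is a convolution with `H`, and the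
claim is `k * (φ * H) = (k * φ) * H` evaluated at `0`. Since `u` is measurable and bounded
everywhere, there is no exceptional set of `ω`. -/
theorem average_average {k φ : G → ℂ} (hk : Integrable k h) (hφ : Integrable φ h) {u : Ω → ℂ}
    (hu : Measurable u) {C : ℝ} (hC : ∀ ω, ‖u ω‖ ≤ C) (ω : Ω) :
    average h k (average h φ u) ω = average h (convOp h k φ) u ω := by
  set H : G → ℂ := fun t => u (t +ᵥ ω)
  have hH : Measurable H := hu.comp (by fun_prop)
  have hHC : ∀ t, ‖H t‖ ≤ C := fun t => hC _
  set L := ContinuousLinearMap.mul ℂ ℂ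
  have := convolution_assoc' (f := k) (g := φ) (k := H) (μ := h) (ν := h) L L L L (x₀ := 0)
    (fun x y z => by simp [L, mul_assoc]) (hk.ae_convolution_exists L hφ)
    (Eventually.of_forall fun x => hφ.mul_bdd (c := C)
      (hH.comp (by fun_prop)).aestronglyMeasurable (Eventually.of_forall fun t => hHC _)) ?_
  · have e1 : ∀ s : G, average h φ u (-s +ᵥ ω) = convolution φ H L h (0 - s) := by
      intro s
      simp [average, convolution_def, L, H, vadd_vadd, sub_eq_add_neg, add_comm]
    have e2 : ∀ s : G, u (-s +ᵥ ω) = H (0 - s) := by simp [H]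
    simp only [average, e2]
    simp only [average] at e1
    simp only [e1]
    exact this.symm
  -- The Fubini condition behind associativity: an integrable function on `G × G` times a bounded
  -- one.
  · have h1 := hk.convolution_integrand L hφ
    refine (h1.mul_bdd (c := C) (g := fun p : G × G => H (0 - p.1))
      (hH.comp (by fun_prop)).aestronglyMeasurable (Eventually.of_forall fun t => hHC _)).congr
      (Eventually.of_forall fun p => ?_)
    simp [L, Function.uncurry, mul_assoc]

theorem ConvergesWeaklyL1.exists_tendsto_average {k : ℕ → G → ℂ}
    (hk : ConvergesWeaklyL1 h k) {u : Ω → ℂ} (hu : Measurable u) {C : ℝ} (hC : ∀ ω, ‖u ω‖ ≤ C)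
    (ω : Ω) : ∃ L : ℂ, Tendsto (fun n => average h (k n) u ω) atTop (𝓝 L) := by
  obtain ⟨v, -, hv⟩ := hk
  exact ⟨_, hv (fun s => u (-s +ᵥ ω)) (memLp_top_of_bound
    (hu.comp (by fun_prop)).aestronglyMeasurable C (Eventually.of_forall fun s => hC _))⟩

/-- The integrals defining the transfer of `k *` exist almost everywhere. -/
theorem MemSum.ae_integrable {k : G → ℂ} (hk : MemLp k ∞ h)
    (hk_supp : ∃ K : Set G, IsCompact K ∧ ∀ᵐ t ∂h, t ∉ K → k t = 0) {f : Ω → ℂ}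
    (hf : MemSum μ f) : ∀ᵐ ω ∂μ, Integrable (fun s => k s * f (-s +ᵥ ω)) h := by
  obtain ⟨f₁, f₂, hf₁, hf₂, rfl⟩ := hf
  obtain ⟨K, hK, hkK⟩ := hk_supp
  have hB : MeasurableSet (-K) := hK.neg.measurableSet
  rw [← Measure.restrict_univ (μ := μ), ← iUnion_spanningSets μ, ae_restrict_iUnion_iff]
  intro n
  have hi := integrableOn_action h μ hf₁ hf₂ (spanningSets μ n) (-K)
    (measure_spanningSets_lt_top μ n) hB hK.neg.measure_lt_top
  rw [IntegrableOn, ← Measure.prod_restrict] at hi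
  filter_upwards [hi.prod_right_ae] with ω hω
  have hω' : IntegrableOn (fun t => (f₁ + f₂) (t +ᵥ ω)) (-K) h := hω
  -- Only the values of `f` on `-K +ᵥ ω` matter, because `k` vanishes off `K`; there `f` is
  -- integrable along the orbit and `k` is essentially bounded.
  have h0 := ((integrable_indicator_iff hB).2 hω').comp_neg.bdd_mul hk.1
    (c := (eLpNormEssSup k h).toReal) (by
      filter_upwards [enorm_ae_le_eLpNormEssSup k h] with s hs
      rw [← toReal_enorm]
      exact ENNReal.toReal_mono (by simpa [eLpNorm_exponent_top] using hk.2.ne) hs)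
  refine h0.congr ?_
  filter_upwards [hkK] with s h2
  by_cases hs : s ∈ K
  · rw [Set.indicator_of_mem (by simpa using hs)]
  · simp [h2 hs]

theorem MemSum.average_add {k : G → ℂ} (hk : MemLp k ∞ h)
    (hk_supp : ∃ K : Set G, IsCompact K ∧ ∀ᵐ t ∂h, t ∉ K → k t = 0) {f g : Ω → ℂ}
    (hf : MemSum μ f) (hg : MemSum μ g) :
    average h k (f + g) =ᵐ[μ] average h k f + average h k g := by
  filter_upwards [hf.ae_integrable hk hk_supp, hg.ae_integrable hk hk_supp] with ω h1 h2
  simp only [average, Pi.add_apply, mul_add]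
  exact integral_add h1 h2

theorem average_smul (k : G → ℂ) (c : ℂ) (f : Ω → ℂ) :
    average h k (c • f) = c • average h k f := by
  ext ω
  simp only [average, Pi.smul_apply, smul_eq_mul, mul_left_comm _ c]
  exact integral_const_mul c _

end Action

end Transfer

namespace Transfer

/-! ### Almost everywhere convergence and the maximal inequality -/

section Convergence

set_option linter.unusedSectionVars false

variable {G Ω : Type*} [AddCommGroup G] [TopologicalSpace G] [IsTopologicalAddGroup G]
  [LocallyCompactSpace G] [T2Space G] [SecondCountableTopology G] [MeasurableSpace G]
  [BorelSpace G] {h : Measure G} [h.IsAddHaarMeasure]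
  [MeasurableSpace Ω] {μ : Measure Ω} [SigmaFinite μ]
  [AddAction G Ω] [MeasurableVAdd₂ G Ω] [VAddInvariantMeasure G Ω μ]

/-- The functions in `L¹ + L^∞` whose averages against the kernels `k n` converge almost
everywhere. -/
def AverageConverges (h : Measure G) (μ : Measure Ω) (k : ℕ → G → ℂ) (f : Ω → ℂ) : Prop :=
  MemSum μ f ∧ ∀ᵐ ω ∂μ, ∃ L : ℂ, Tendsto (fun n => average h (k n) f ω) atTop (𝓝 L)

theorem AverageConverges.add {k : ℕ → G → ℂ} (hk_bdd : ∀ n, MemLp (k n) ∞ h)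
    (hk_supp : ∀ n, ∃ K : Set G, IsCompact K ∧ ∀ᵐ t ∂h, t ∉ K → k n t = 0) {f g : Ω → ℂ}
    (hf : AverageConverges h μ k f) (hg : AverageConverges h μ k g) :
    AverageConverges h μ k (f + g) := by
  refine ⟨hf.1.add hg.1, ?_⟩
  filter_upwards [hf.2, hg.2,
    ae_all_iff.2 fun n => MemSum.average_add (hk_bdd n) (hk_supp n) hf.1 hg.1]
    with ω ⟨L, hL⟩ ⟨L', hL'⟩ h3
  simp only [h3]
  exact ⟨_, hL.add hL'⟩

theorem AverageConverges.const_smul {k : ℕ → G → ℂ} {f : Ω → ℂ}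
    (hf : AverageConverges h μ k f) (c : ℂ) : AverageConverges h μ k (c • f) := by
  refine ⟨hf.1.const_smul c, ?_⟩
  filter_upwards [hf.2] with ω ⟨L, hL⟩
  simp only [average_smul]
  exact ⟨_, hL.const_smul c⟩

theorem transfer_ae_eq_average {k : G → ℂ} (hk_bdd : MemLp k ∞ h)
    (hk_supp : ∃ K : Set G, IsCompact K ∧ ∀ᵐ t ∂h, t ∉ K → k t = 0) {f : Ω → ℂ}
    (hf : MemSum μ f) : transfer h μ (convOp h k) f =ᵐ[μ] average h k f := by
  obtain ⟨f₁, f₂, h1, h2, h3⟩ := hf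
  exact (transfer_convOp_ae_eq h μ hk_bdd hk_supp h1 h2 h3).2

/-- A maximal inequality passes almost everywhere convergence to limits in the Orlicz space. -/
theorem AverageConverges.of_approx {k : ℕ → G → ℂ} (hk_bdd : ∀ n, MemLp (k n) ∞ h)
    (hk_supp : ∀ n, ∃ K : Set G, IsCompact K ∧ ∀ᵐ t ∂h, t ∉ K → k n t = 0)
    {Φ : ℝ≥0 → ℝ≥0∞} {φ : ℝ≥0 → ℝ≥0} (hφ : ∀ t, φ t = 0 → t = 0)
    (hT : HasWeakType μ Φ φ fun f ω => ⨆ n, ‖transfer h μ (convOp h (k n)) f ω‖ₑ)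
    {f : Ω → ℂ} (hf : MemSum μ f)
    (happ : ∀ r : ℝ≥0, 0 < r → ∃ g, AverageConverges h μ k g ∧
      ∫⁻ ω, Φ (r * ‖f ω - g ω‖₊) ∂μ ≤ 1) : AverageConverges h μ k f := by
  refine ⟨hf, ?_⟩
  obtain ⟨c, hc⟩ := hT
  -- The set where the tails oscillate by more than `3 * s` is shown to have measure at most `t` for
  -- every `t > 0`, with an approximant `g` that depends on `s` and `t`.
  have key : ∀ s : ℝ≥0, 0 < s → μ {ω | ¬ ∃ N, ∀ m ≥ N, ∀ n ≥ N,
      ‖average h (k m) f ω - average h (k n) f ω‖ ≤ 3 * s} = 0 := by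
    intro s hs
    refine le_antisymm (ENNReal.le_of_forall_pos_le_add fun t ht _ => ?_) zero_le
    rw [zero_add]
    have hφt : 0 < φ t := pos_iff_ne_zero.2 fun h0 => ht.ne' (hφ t h0)
    -- Chosen so that `c / r < s * φ t`; with `c + 1` in place of `c` the inequality is strict and
    -- `r` is positive even if `c = 0`.
    set r : ℝ≥0 := (c + 1) / (s * φ t)
    have hr : 0 < r := by positivity
    obtain ⟨g, hg, hgr⟩ := happ r hr
    set D : Ω → ℂ := f - g
    have hD : MemSum μ D := hf.sub hg.1
    have hlux : luxemburgNorm μ Φ D ≤ (r : ℝ≥0∞)⁻¹ := luxemburgNorm_le hr hgr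
    have hmax := hc D ⟨hD.aestronglyMeasurable,
      hlux.trans_lt (by simpa using hr)⟩
    have hrearr : rearrangement μ (fun ω => ⨆ n, ‖transfer h μ (convOp h (k n)) D ω‖ₑ) t < s := by
      have h1 : rearrangement μ (fun ω => ⨆ n, ‖transfer h μ (convOp h (k n)) D ω‖ₑ) t * φ t <
          s * φ t := by
        calc _ ≤ mStarNorm μ φ _ := le_iSup₂_of_le t ht le_rfl
          _ ≤ c * (r : ℝ≥0∞)⁻¹ := hmax.trans (by gcongr)
          _ < s * φ t := by
            rw [← ENNReal.coe_inv hr.ne']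
            norm_cast
            rw [← div_eq_mul_inv, div_lt_iff₀ hr]
            simp only [r]
            rw [mul_div_cancel₀ _ (by positivity)]
            exact lt_add_one c
      exact lt_of_mul_lt_mul_right' h1
    refine (measure_mono_ae ?_).trans (measure_lt_le_of_rearrangement_lt hrearr)
    filter_upwards [hg.2,
      ae_all_iff.2 fun n => MemSum.average_add (hk_bdd n) (hk_supp n) hg.1 hD,
      ae_all_iff.2 fun n => transfer_ae_eq_average (hk_bdd n) (hk_supp n) hD]
      with ω ⟨L, hL⟩ h2 h3 hω
    -- Where the maximal function of `D = f - g` is at most `s`, two averages of `D` contribute at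
    -- most `2 * s` and the Cauchy tail of `g` less than `s`, so such `ω` are not in the bad set.
    by_contra hle
    refine hω ?_
    have hle' : ∀ n, ‖average h (k n) D ω‖ ≤ s := by
      intro n
      have := (le_iSup (fun n => ‖transfer h μ (convOp h (k n)) D ω‖ₑ) n).trans (not_lt.1 hle)
      rw [h3 n, enorm_eq_nnnorm] at this
      exact_mod_cast this
    obtain ⟨N, hN⟩ := Metric.cauchySeq_iff.1 hL.cauchySeq s hs
    refine ⟨N, fun m hm n hn => ?_⟩
    have hgD : g + D = f := by simp [D]
    have e := fun n => h2 n
    simp only [hgD, Pi.add_apply] at e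
    have h4 := hN m hm n hn
    rw [dist_eq_norm] at h4
    calc ‖average h (k m) f ω - average h (k n) f ω‖
        = ‖(average h (k m) g ω - average h (k n) g ω) +
            (average h (k m) D ω - average h (k n) D ω)‖ := by rw [e, e]; ring_nf
      _ ≤ ‖average h (k m) g ω - average h (k n) g ω‖ +
            (‖average h (k m) D ω‖ + ‖average h (k n) D ω‖) :=
          (norm_add_le _ _).trans (add_le_add le_rfl (norm_sub_le _ _))
      _ ≤ 3 * s := by linarith [hle' m, hle' n]
  have hall : ∀ᵐ ω ∂μ, ∀ j : ℕ, ∃ N, ∀ m ≥ N, ∀ n ≥ N,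
      ‖average h (k m) f ω - average h (k n) f ω‖ ≤ 3 * (1 / ((j : ℝ≥0) + 1) : ℝ≥0) :=
    ae_all_iff.2 fun j => key _ (by positivity)
  filter_upwards [hall] with ω hω
  refine cauchySeq_tendsto_of_complete (Metric.cauchySeq_iff.2 fun ε hε => ?_)
  obtain ⟨j, hj⟩ := exists_nat_one_div_lt (show (0 : ℝ) < ε / 3 by positivity)
  obtain ⟨N, hN⟩ := hω j
  refine ⟨N, fun m hm n hn => ?_⟩
  rw [dist_eq_norm]
  refine (hN m hm n hn).trans_lt ?_
  push_cast
  linarith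

end Convergence

end Transfer

/-! ### From averages to indicators, simple functions and the whole Orlicz space -/

theorem mainTheorem6 {G Ω : Type*}
    [AddCommGroup G] [TopologicalSpace G] [IsTopologicalAddGroup G] [LocallyCompactSpace G]
    [T2Space G] [SecondCountableTopology G] [MeasurableSpace G] [BorelSpace G]
    (h : Measure G) [h.IsAddHaarMeasure]
    [MeasurableSpace Ω] (μ : Measure Ω) [SigmaFinite μ]
    [AddAction G Ω] [MeasurableVAdd₂ G Ω] [VAddInvariantMeasure G Ω μ]
    (hres : IsResonant μ)
    (hcont : IsPointWeakStarContinuous G μ)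
    (k : ℕ → G → ℂ)
    (hk_int : ∀ n, Integrable (k n) h)
    (hk_bdd : ∀ n, MemLp (k n) ∞ h)
    (hk_supp : ∀ n, ∃ K : Set G, IsCompact K ∧ ∀ᵐ t ∂h, t ∉ K → k n t = 0)
    (hk_lim : ∃ c : ℂ, Tendsto (fun n => ∫ t, k n t ∂h) atTop (𝓝 c))
    (hk_weak : ∀ φ : G → ℂ, Integrable φ h → h (Function.support φ) < ∞ →
      ConvergesWeaklyL1 h fun n => convOp h (k n) φ)
    (Φ : ℝ≥0 → ℝ≥0∞) (hΦ : IsYoungFunction Φ) (hΔ : Delta2 Φ)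
    (Y : RIFunctionNorm μ) (φY : ℝ≥0 → ℝ≥0) (hφY : Y.IsFundamentalFunction φY)
    (hT : HasWeakType μ Φ φY fun f ω => ⨆ n, ‖transfer h μ (convOp h (k n)) f ω‖ₑ)
    (f : Ω → ℂ) (hf : MemOrlicz μ Φ f) :
    ∀ᵐ ω ∂μ, ∃ L : ℂ,
      Tendsto (fun n => transfer h μ (convOp h (k n)) f ω) atTop (𝓝 L) := by
  have hφ : ∀ t, φY t = 0 → t = 0 := fun t => (hφY.1.eq_zero_iff t).1
  have hind : ∀ E, MeasurableSet E → μ E < ∞ →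
      AverageConverges h μ k (E.indicator (1 : Ω → ℂ)) := by
    intro E hE hμE
    have hem : Measurable (E.indicator (1 : Ω → ℂ)) := measurable_one.indicator hE
    have he1 : ∀ ω, ‖E.indicator (1 : Ω → ℂ) ω‖ ≤ 1 := fun ω => by
      by_cases hω : ω ∈ E <;> simp [hω]
    have heL : MemLp (E.indicator (1 : Ω → ℂ)) ∞ μ :=
      memLp_top_of_bound hem.aestronglyMeasurable 1 (Eventually.of_forall he1)
    refine .of_approx hk_bdd hk_supp hφ hT heL.memSum fun r hr => ?_
    have hr0 := hΦ.map_ne_zero hΔ hr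
    have hrt := hΦ.ne_top hΔ r
    -- The tolerance `(Φ r)⁻¹` makes the modular of the error at scale `r` at most `Φ r * (Φ r)⁻¹ =
    -- 1`.
    obtain ⟨φ, hφi, hφs, hφb, hφδ⟩ := exists_average_indicator_approx (h := h) hcont hE hμE
      (ENNReal.inv_pos.2 hrt)
    refine ⟨average h φ (E.indicator 1), ⟨?_, Eventually.of_forall fun ω => ?_⟩, ?_⟩
    · refine (memLp_top_of_bound (C := 2) ?_ (Eventually.of_forall fun ω => ?_)).memSum
      · refine AEStronglyMeasurable.integral_prod_right'
          (f := fun p : Ω × G => φ p.2 * E.indicator (1 : Ω → ℂ) (-p.2 +ᵥ p.1)) ?_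
        exact hφi.1.comp_snd.mul (hem.comp (by fun_prop)).aestronglyMeasurable
      · have := norm_sub_norm_le (average h φ (E.indicator 1) ω) (E.indicator 1 ω)
        rw [norm_sub_rev] at this
        linarith [hφb ω, he1 ω]
    · simp only [average_average (hk_int _) hφi hem he1]
      exact (hk_weak φ hφi hφs).exists_tendsto_average hem he1 ω
    · refine (lintegral_young_le hΦ hφb r hrt).trans ?_
      calc _ ≤ Φ r * (Φ r)⁻¹ := by gcongr
        _ = 1 := ENNReal.mul_inv_cancel hr0 hrt
  have hsimple : ∀ S : SimpleFunc Ω ℂ, Integrable S μ → AverageConverges h μ k S := by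
    intro S
    induction S using SimpleFunc.induction with
    | const c hs =>
      rename_i s
      intro hi
      -- For `c = 0` integrability says nothing about `μ s`, so the zero function is written as a
      -- multiple of `χ_∅`.
      by_cases hc : c = 0
      · convert (hind ∅ .empty (by simp)).const_smul 0 using 1
        ext ω
        simp [hc]
      · have hμs : μ s < ∞ := by
          have e : ⇑(SimpleFunc.piecewise s hs (.const Ω c) (.const Ω 0)) =
              s.indicator fun _ => c := by
            ext ω
            by_cases hω : ω ∈ s <;> simp [hω]
          rw [e] at hi
          simpa [hc, integrable_indicator_iff hs, integrableOn_const_iff] using hi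
        convert (hind s hs hμs).const_smul c using 1
        ext ω
        by_cases hω : ω ∈ s <;> simp [hω]
    | add hfg h1 h2 =>
      intro hi
      rw [SimpleFunc.coe_add, integrable_add_of_disjoint hfg (SimpleFunc.stronglyMeasurable _)
        (SimpleFunc.stronglyMeasurable _)] at hi
      rw [SimpleFunc.coe_add]
      exact (h1 hi.1).add hk_bdd hk_supp (h2 hi.2)
  have hfs := hf.memSum hΦ hΔ
  -- Second use of the maximal inequality, now with integrable simple functions as the dense class.
  have hconv : AverageConverges h μ k f := .of_approx hk_bdd hk_supp hφ hT hfs fun r _ => by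
    obtain ⟨S, hS, hSr⟩ := hf.exists_simpleFunc hΦ hΔ r
    exact ⟨S, hsimple S hS, hSr⟩
  filter_upwards [hconv.2,
    ae_all_iff.2 fun n => transfer_ae_eq_average (hk_bdd n) (hk_supp n) hfs] with ω h1 h2
  simpa only [h2] using h1
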